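/- Let $\mathscr H_A,\mathscr H_B$ be complex Hilbert spaces of finite dimensions $d_A,d_B$ with $d_Ad_B\ge 3$, and let $\hat N_A$ be a Hermitian operator on $\mathscr H_A$. For a density operator $\rho$ on $\mathscr H_A\otimes\mathscr H_B$ (positive semidefinite, trace one) let $S(\rho)=-\operatorname{Tr}(\rho\log\rho)$ be its von Neumann entropy, let $\rho|_{\hat N_A}=\sum_{\mu}\Pi_\mu\rho\,\Pi_\mu$, where $\Pi_\mu$ is the orthogonal projector onto the eigenspace of $\hat N_A\otimes 1_B$ for the eigenvalue $\mu$ and the sum runs over the distinct eigenvalues, and let $\Delta S(\rho)=S(\rho|_{\hat N_A})-S(\rho)$ be the number entanglement. Let $\rho,\sigma$ be density operators on $\mathscr H_A\otimes\mathscr H_B$. (1) For every finite-dimensional Hilbert space $\mathscr H_C$ and all purifications $|\phi\rangle,|\psi\rangle\in\mathscr H_A\otimes\mathscr H_B\otimes\mathscr H_C$ of $\rho$ and $\sigma$, i.e. $\operatorname{Tr}_C|\phi\rangle\langle\phi|=\rho$ and $\operatorname{Tr}_C|\psi\rangle\langle\psi|=\sigma$, $$|\Delta S(\sigma)-\Delta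 S(\rho)|\le 4\sqrt2\,\log(d_Ad_B)\,\bigl\lVert|\psi\rangle-|\phi\rangle\bigr\rVert_2 .$$ The constant may be relaxed to $4\sqrt2\log D$ for any integer $D\ge d_Ad_B$, in particular for $D$ the dimension of the purification space. (2) Consequently, with the fidelity $F(\sigma,\rho)=\bigl(\operatorname{Tr}\sqrt{\sqrt\sigma\,\rho\sqrt\sigma}\bigr)^2$ and the Bures distance $D_B(\sigma,\rho)=\sqrt{2\bigl(1-\sqrt{F(\sigma,\rho)}\bigr)}$, $$|\Delta S(\sigma)-\Delta S(\rho)|\le 4\sqrt2\,\log(d_Ad_B)\,D_B(\sigma,\rho).$$ -/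

import Mathlib

open scoped ComplexOrder Kronecker

noncomputable section

namespace NumberEntanglement

/-- A density matrix: positive semidefinite with unit trace. -/
def IsDensity {n : Type*} [Fintype n] (ρ : Matrix n n ℂ) : Prop :=
  ρ.PosSemidef ∧ ρ.trace = 1

/-- The von Neumann entropy `S(ρ) = -Tr(ρ log ρ)` (natural logarithm). The logarithm is taken by
functional calculus of the Hermitian matrix `ρ`; since `Real.log 0 = 0`, the convention
`0 log 0 = 0` is respected. -/
def entropy {n : Type*} [Fintype n] [DecidableEq n] (ρ : Matrix n n ℂ) : ℝ :=
  -(ρ * cfc Real.log ρ).trace.re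

/-- The matrix of the orthogonal projection of `ℂ^n` (Euclidean norm) onto the eigenspace of `N`
for the eigenvalue `μ`. -/
def eigenProj {n : Type*} [Fintype n] [DecidableEq n] (N : Matrix n n ℂ) (μ : ℂ) :
    Matrix n n ℂ :=
  (Matrix.toEuclideanLin (𝕜 := ℂ) (m := n) (n := n)).symm
    ((Module.End.eigenspace (Matrix.toEuclideanLin N) μ).starProjection :
      EuclideanSpace ℂ n →ₗ[ℂ] EuclideanSpace ℂ n)

/-- The state `ρ|_N = ∑_μ Π_μ ρ Π_μ` after a nonselective measurement of the observable `N`; the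
sum runs over the distinct eigenvalues of `N`. -/
def measured {n : Type*} [Fintype n] [DecidableEq n] (N ρ : Matrix n n ℂ) : Matrix n n ℂ :=
  ∑ μ : Module.End.Eigenvalues (Matrix.toEuclideanLin (𝕜 := ℂ) N),
    eigenProj N (μ : ℂ) * ρ * eigenProj N (μ : ℂ)

/-- The number entanglement of `ρ` with respect to the local observable `N_A ⊗ 1_B`:
`ΔS(ρ) = S(ρ|_{N_A ⊗ 1_B}) - S(ρ)`. -/
def numberEntanglement {A B : Type*} [Fintype A] [DecidableEq A] [Fintype B] [DecidableEq B]
    (NA : Matrix A A ℂ) (ρ : Matrix (A × B) (A × B) ℂ) : ℝ :=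
  entropy (measured (NA ⊗ₖ (1 : Matrix B B ℂ)) ρ) - entropy ρ

/-- The partial trace over the second factor `ℂ^C` of `ℂ^n ⊗ ℂ^C = ℂ^(n × C)`. -/
def partialTrace {n C : Type*} [Fintype C] (M : Matrix (n × C) (n × C) ℂ) : Matrix n n ℂ :=
  Matrix.of fun i j => ∑ k, M (i, k) (j, k)

/-- The vector `ψ` of `ℂ^n ⊗ ℂ^C` is a purification of `ρ`: `Tr_C |ψ⟩⟨ψ| = ρ`. -/
def IsPurification {n C : Type*} [Fintype C]
    (ψ : EuclideanSpace ℂ (n × C)) (ρ : Matrix n n ℂ) : Prop :=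
  partialTrace (Matrix.vecMulVec (fun x => ψ x) (fun x => star (ψ x))) = ρ

/-- The fidelity `F(ρ, σ) = (Tr √(√ρ σ √ρ))²`. -/
def fidelity {n : Type*} [Fintype n] [DecidableEq n] (ρ σ : Matrix n n ℂ) : ℝ :=
  ((cfc Real.sqrt (cfc Real.sqrt ρ * σ * cfc Real.sqrt ρ)).trace.re) ^ 2

/-- The Bures distance `D_B(ρ, σ) = √(2 (1 - √F(ρ, σ)))`. -/
def buresDist {n : Type*} [Fintype n] [DecidableEq n] (ρ σ : Matrix n n ℂ) : ℝ :=
  Real.sqrt (2 * (1 - Real.sqrt (fidelity ρ σ)))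

end NumberEntanglement

end

open NumberEntanglement

universe u v w

namespace NumberEntanglement

open Real

/-! ### The Shannon entropy as a function of amplitudes -/

/-! A purification of `ρ` is a matrix `X` of amplitudes with `X * Xᴴ = ρ`, and distance of
purifications is Hilbert–Schmidt distance. The entropy of `X * Xᴴ` is Lipschitz in `X` with constant
`2√2 log d` (`abs_entropy_sub_entropy_le`): in an eigenbasis of `X * Xᴴ` it reduces to the Shannon
entropy of squared row norms, whose gradient in the amplitudes has squared norm `4 ∑ p (1 + log
p)²`, at most `8 log² d` once `d ≥ 3`. The measured state has amplitudes depending linearly and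
isometrically on `X`, so its entropy obeys the same bound, and the two add up to `4√2 log d`. For
the Bures bound, `exists_hsSq_sub_eq_buresDist` gives amplitudes at exactly that distance. -/

lemma sub_one_sq_le_one_add_exp {u : ℝ} (hu : 0 ≤ u) : (u - 1) ^ 2 ≤ 1 + rexp u / 3 := by
  -- Degree 4 is needed: the cubic Taylor polynomial is too small near `u = 5`.
  have h := Real.sum_le_exp_of_nonneg hu 5
  simp only [Finset.sum_range_succ, Finset.sum_range_zero, Nat.factorial] at h
  norm_num at h
  nlinarith [mul_nonneg hu (sq_nonneg (u - 5)), mul_nonneg hu (sq_nonneg (u - 4)),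
    sq_nonneg (u ^ 2 - 4 * u), sq_nonneg (u ^ 2 - 5 * u), sq_nonneg (u ^ 2), sq_nonneg u]

/-- Used with `v = log (x d)` and `M = log d - 1`, so that `v - M = 1 + log x`, and `v ≤ M + 1` says
`x ≤ 1`. -/
lemma sub_sq_le_max_add_exp {v M : ℝ} (hM : 0 ≤ M) (hv : v ≤ M + 1) :
    (v - M) ^ 2 ≤ (max 1 M) ^ 2 + 2 * max 1 M * rexp (-v) := by
  have h1 : 1 ≤ max 1 M := le_max_left _ _
  have h2 : M ≤ max 1 M := le_max_right _ _
  generalize max 1 M = a at *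
  rcases le_total 0 v with h | h
  · have : 0 ≤ 2 * a * rexp (-v) := by positivity
    have : |v - M| ≤ |a| := by
      rw [abs_of_nonneg (by linarith : 0 ≤ a), abs_le]; constructor <;> linarith
    have := sq_le_sq.2 this
    linarith
  · have hq := Real.quadratic_le_exp_of_nonneg (neg_nonneg.2 h)
    nlinarith [mul_le_mul_of_nonneg_left hq (by linarith : 0 ≤ 2 * a),
      mul_nonneg (neg_nonneg.2 h) (sub_nonneg.2 h2), mul_nonneg (sub_nonneg.2 h1) (sq_nonneg v)]

/-- An affine majorant of `x ↦ x (1 + log x)²` on `(0, 1]`. -/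
lemma exists_mul_one_add_log_sq_le {d : ℕ} (hd : 3 ≤ d) : ∃ a b : ℝ, 0 ≤ a ∧ 0 ≤ b ∧
    a + d * b ≤ 2 * log d ^ 2 ∧ ∀ x, 0 ≤ x → x ≤ 1 → x * (1 + log x) ^ 2 ≤ a * x + b := by
  rcases hd.eq_or_lt with rfl | hd
  -- The general choice below costs `3` when `M ≤ 1`, more than `2 log² 3 ≈ 2.41`; this one costs
  -- `2`.
  · refine ⟨1, 1 / 3, by norm_num, by norm_num, ?_, fun x hx hx1 => ?_⟩
    · have := Real.log_three_gt_d9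
      push_cast
      nlinarith
    · rcases hx.eq_or_lt with rfl | hx
      · norm_num
      have h := sub_one_sq_le_one_add_exp (u := -log x) (by linarith [log_nonpos hx.le hx1])
      rw [Real.exp_neg, exp_log hx] at h
      have := mul_le_mul_of_nonneg_left h hx.le
      have e : x * (1 + x⁻¹ / 3) = 1 * x + 1 / 3 := by field_simp
      linarith [e, show x * (-log x - 1) ^ 2 = x * (1 + log x) ^ 2 by ring]
  · have hd0 : (0 : ℝ) < d := by positivity
    have hL : 1.38 ≤ log d := by
      have h4 : log 4 ≤ log d := log_le_log (by norm_num) (by exact_mod_cast hd)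
      have : log 4 = 2 * log 2 := by
        rw [show (4 : ℝ) = 2 ^ 2 by norm_num, Real.log_pow]; norm_num
      linarith [Real.log_two_gt_d9]
    set M := log d - 1 with hM
    have hM0 : 0 ≤ M := by linarith
    refine ⟨(max 1 M) ^ 2, 2 * max 1 M / d, by positivity, by positivity, ?_, fun x hx hx1 => ?_⟩
    · rw [mul_div_cancel₀ _ hd0.ne']
      rcases le_total 1 M with h | h
      · rw [max_eq_right h]; nlinarith
      · rw [max_eq_left h]; nlinarith
    · rcases hx.eq_or_lt with rfl | hx
      · simp; positivity
      have h := sub_sq_le_max_add_exp (v := log x + log d) hM0 (by linarith [log_nonpos hx.le hx1])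
      rw [← log_mul hx.ne' hd0.ne', Real.exp_neg, exp_log (by positivity),
        log_mul hx.ne' hd0.ne'] at h
      have := mul_le_mul_of_nonneg_left h hx.le
      have e : x * ((max 1 M) ^ 2 + 2 * max 1 M * (x * d)⁻¹) =
        (max 1 M) ^ 2 * x + 2 * max 1 M / d := by field_simp
      rw [e] at this
      rwa [show log x + log d - M = 1 + log x by rw [hM]; ring] at this

/-- Sum the affine majorant. Total mass below 1 is allowed because chords of the sphere pass inside
the ball. For `d = 2` the bound fails at `p = (1, 0)`. -/
lemma sum_mul_one_add_log_sq_le {n : Type*} [Fintype n] (hd : 3 ≤ Fintype.card n) {p : n → ℝ}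
    (hp : ∀ j, 0 ≤ p j) (hsum : ∑ j, p j ≤ 1) :
    ∑ j, p j * (1 + log (p j)) ^ 2 ≤ 2 * log (Fintype.card n) ^ 2 := by
  obtain ⟨a, b, ha, hb, hab, h⟩ := exists_mul_one_add_log_sq_le hd
  calc ∑ j, p j * (1 + log (p j)) ^ 2 ≤ ∑ j, (a * p j + b) :=
        Finset.sum_le_sum fun j _ => h _ (hp j)
          ((Finset.single_le_sum (fun i _ => hp i) (Finset.mem_univ j)).trans hsum)
    _ = a * ∑ j, p j + Fintype.card n * b := by
        simp [Finset.sum_add_distrib, Finset.mul_sum]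
    _ ≤ _ := by nlinarith

lemma continuous_negMulLog_sq : Continuous fun x : ℝ => negMulLog (x ^ 2) :=
  continuous_negMulLog.comp (by fun_prop)

/-- On the segment between nonnegative unit vectors the gradient of `r ↦ ∑ j, negMulLog (r j ^ 2)`
has norm at most `√8 log d`. -/
lemma sum_negMulLog_sq_sub_le {n : Type*} [Fintype n] (hd : 3 ≤ Fintype.card n) {r s : n → ℝ}
    (hr : ∀ j, 0 ≤ r j) (hs : ∀ j, 0 ≤ s j) (hr1 : ∑ j, r j ^ 2 = 1) (hs1 : ∑ j, s j ^ 2 = 1) :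
    ∑ j, negMulLog (s j ^ 2) - ∑ j, negMulLog (r j ^ 2) ≤
      2 * √2 * log (Fintype.card n) * √(∑ j, (s j - r j) ^ 2) := by
  set x : ℝ → n → ℝ := fun t j => r j + t * (s j - r j) with hx
  set g : ℝ → ℝ := fun t => ∑ j, negMulLog (x t j ^ 2) with hg
  set dg : ℝ → ℝ := fun t => ∑ j, (-(2 * x t j * (1 + log (x t j ^ 2)))) * (s j - r j) with hdg
  have hcont : ContinuousOn g (Set.Icc 0 1) := by
    apply Continuous.continuousOn
    refine continuous_finsetSum _ fun j _ => continuous_negMulLog_sq.comp ?_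
    simp only [hx]; fun_prop
  have hder : ∀ t ∈ Set.Ioo (0 : ℝ) 1, HasDerivAt g (dg t) t := by
    intro t ht
    refine HasDerivAt.fun_sum fun j _ => ?_
    have hxd : HasDerivAt (fun t => x t j) (s j - r j) t := by
      simpa [hx] using ((hasDerivAt_id t).mul_const (s j - r j)).const_add (r j)
    -- `negMulLog` is not differentiable at 0, but a coordinate vanishing inside the segment
    -- vanishes at both ends, so its term is constant.
    by_cases h0 : x t j = 0
    · have e : x t j = (1 - t) * r j + t * s j := by simp only [hx]; ring
      have h1 := mul_nonneg (sub_nonneg.2 ht.2.le) (hr j)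
      have h2 := mul_nonneg ht.1.le (hs j)
      have hr0 : r j = 0 := by
        have : (1 - t) * r j = 0 := by linarith
        exact (mul_eq_zero.1 this).resolve_left (by linarith [ht.2])
      have hs0 : s j = 0 := by
        have : t * s j = 0 := by linarith
        exact (mul_eq_zero.1 this).resolve_left ht.1.ne'
      simpa [hx, hr0, hs0] using hasDerivAt_const t (0 : ℝ)
    · have := (hasDerivAt_negMulLog (pow_ne_zero 2 h0)).comp t (hxd.pow 2)
      refine this.congr_deriv ?_
      simp; ring
  obtain ⟨t, ht, he⟩ := exists_hasDerivAt_eq_slope g dg one_pos hcont hder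
  have h01 : g 1 - g 0 = dg t := by rw [he]; simp
  have hL : ∑ j, negMulLog (s j ^ 2) - ∑ j, negMulLog (r j ^ 2) = dg t := by
    rw [← h01]; simp [hg, hx]
  have hq : ∑ j, x t j ^ 2 ≤ 1 := by
    calc ∑ j, x t j ^ 2 ≤ ∑ j, ((1 - t) * r j ^ 2 + t * s j ^ 2) := by
          refine Finset.sum_le_sum fun j _ => ?_
          simp only [hx]
          nlinarith [mul_nonneg (mul_nonneg ht.1.le (sub_nonneg.2 ht.2.le)) (sq_nonneg (s j - r j))]
      _ = 1 := by
          rw [Finset.sum_add_distrib, ← Finset.mul_sum, ← Finset.mul_sum, hr1, hs1]; ring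
  have hgrad := sum_mul_one_add_log_sq_le hd (fun j => sq_nonneg (x t j)) hq
  have hlog : 0 ≤ log (Fintype.card n : ℝ) := Real.log_natCast_nonneg _
  rw [hL]
  refine (Real.sum_mul_le_sqrt_mul_sqrt _ _ _).trans ?_
  refine mul_le_mul_of_nonneg_right ?_ (Real.sqrt_nonneg _)
  refine Real.sqrt_le_iff.2 ⟨by positivity, ?_⟩
  have e : ∑ j, (-(2 * x t j * (1 + log (x t j ^ 2)))) ^ 2 =
      4 * ∑ j, x t j ^ 2 * (1 + log (x t j ^ 2)) ^ 2 := by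
    rw [Finset.mul_sum]; exact Finset.sum_congr rfl fun j _ => by ring
  rw [e, mul_pow, mul_pow, Real.sq_sqrt (by norm_num)]
  linarith

end NumberEntanglement

namespace NumberEntanglement

open Real Matrix

/-! ### Hilbert–Schmidt norm and rows of a matrix -/

section HilbertSchmidt

variable {n m : Type*} [Fintype n] [Fintype m]

/-- The squared Hilbert–Schmidt norm. -/
noncomputable def hsSq (X : Matrix n m ℂ) : ℝ := ∑ i, ∑ k, ‖X i k‖ ^ 2

lemma hsSq_eq_re_trace (X : Matrix n m ℂ) : hsSq X = (X * Xᴴ).trace.re := by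
  simp only [hsSq, trace, diag, Matrix.mul_apply, conjTranspose_apply, Complex.re_sum]
  refine Finset.sum_congr rfl fun i _ => Finset.sum_congr rfl fun k _ => ?_
  rw [RCLike.star_def, Complex.mul_conj, Complex.ofReal_re, Complex.normSq_eq_norm_sq]

lemma hsSq_sub (X Y : Matrix n m ℂ) :
    hsSq (Y - X) = hsSq Y + hsSq X - 2 * (Y * Xᴴ).trace.re := by
  have e : (X * Yᴴ).trace.re = (Y * Xᴴ).trace.re := by
    rw [show X * Yᴴ = (Y * Xᴴ)ᴴ by rw [conjTranspose_mul, conjTranspose_conjTranspose],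
      trace_conjTranspose]
    simp
  simp only [hsSq_eq_re_trace, conjTranspose_sub, Matrix.sub_mul, Matrix.mul_sub, trace_sub,
    Complex.sub_re, e]
  ring

/-- The Euclidean norm of a row of a matrix. -/
noncomputable def rowNorm (X : Matrix n m ℂ) (j : n) : ℝ := ‖WithLp.toLp 2 (X j)‖

lemma rowNorm_sq {n m : Type*} [Fintype m] (X : Matrix n m ℂ) (j : n) : rowNorm X j ^ 2 = ∑ k, ‖X j k‖ ^ 2 := by
  rw [rowNorm, EuclideanSpace.norm_sq_eq]

lemma sum_rowNorm_sq (X : Matrix n m ℂ) : ∑ j, rowNorm X j ^ 2 = hsSq X := by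
  simp only [rowNorm_sq, hsSq]

lemma sum_rowNorm_sub_sq_le (X Y : Matrix n m ℂ) :
    ∑ j, (rowNorm Y j - rowNorm X j) ^ 2 ≤ hsSq (Y - X) := by
  rw [← sum_rowNorm_sq]
  refine Finset.sum_le_sum fun j _ => ?_
  rw [sq_le_sq, abs_of_nonneg (a := rowNorm (Y - X) j) (norm_nonneg _)]
  exact abs_norm_sub_norm_le _ _

lemma diag_re_eq_rowNorm_sq (V : Matrix n n ℂ) (X : Matrix n m ℂ) (j : n) :
    ((star V * (X * Xᴴ) * V) j j).re = rowNorm (star V * X) j ^ 2 := by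
  have e : star V * (X * Xᴴ) * V = (star V * X) * (star V * X)ᴴ := by
    rw [conjTranspose_mul, star_eq_conjTranspose, conjTranspose_conjTranspose]
    simp only [Matrix.mul_assoc]
  rw [e, rowNorm_sq, Matrix.mul_apply, Complex.re_sum]
  refine Finset.sum_congr rfl fun k _ => ?_
  rw [conjTranspose_apply, RCLike.star_def, Complex.mul_conj, Complex.ofReal_re,
    Complex.normSq_eq_norm_sq]

end HilbertSchmidt

/-! ### Entropy and diagonal entries -/

section Entropy

variable {n m : Type*} [Fintype n] [DecidableEq n] [Fintype m]

lemma eq_conj_diagonal {ρ : Matrix n n ℂ} (h : ρ.IsHermitian) :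
    ρ = (h.eigenvectorUnitary : Matrix n n ℂ) * diagonal (fun i => (h.eigenvalues i : ℂ)) *
      star (h.eigenvectorUnitary : Matrix n n ℂ) := by
  conv_lhs => rw [h.spectral_theorem, Unitary.conjStarAlgAut_apply]
  rfl

lemma cfc_eq_conj_diagonal {ρ : Matrix n n ℂ} (h : ρ.IsHermitian) (f : ℝ → ℝ) :
    cfc f ρ = (h.eigenvectorUnitary : Matrix n n ℂ) *
      diagonal (fun i => (f (h.eigenvalues i) : ℂ)) *
      star (h.eigenvectorUnitary : Matrix n n ℂ) := by
  rw [h.cfc_eq, Matrix.IsHermitian.cfc, Unitary.conjStarAlgAut_apply]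
  rfl

lemma entropy_eq_sum_negMulLog {ρ : Matrix n n ℂ} (h : ρ.IsHermitian) :
    entropy ρ = ∑ i, negMulLog (h.eigenvalues i) := by
  have hU : star (h.eigenvectorUnitary : Matrix n n ℂ) * h.eigenvectorUnitary = 1 :=
    Unitary.coe_star_mul_self _
  have h1 := eq_conj_diagonal h
  have h2 := cfc_eq_conj_diagonal h Real.log
  generalize (h.eigenvectorUnitary : Matrix n n ℂ) = U at *
  generalize h.eigenvalues = l at *
  rw [entropy, h2]
  conv_lhs => rw [h1]
  have e : U * diagonal (fun i => (l i : ℂ)) * star U *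
      (U * diagonal (fun i => (Real.log (l i) : ℂ)) * star U) =
      U * (diagonal (fun i => (l i : ℂ)) * diagonal (fun i => (Real.log (l i) : ℂ)) * star U) := by
    simp only [Matrix.mul_assoc]
    rw [← Matrix.mul_assoc (star U) U, hU, Matrix.one_mul]
  rw [e, Matrix.trace_mul_comm, Matrix.mul_assoc, hU, Matrix.mul_one, diagonal_mul_diagonal,
    trace_diagonal, Complex.re_sum, ← Finset.sum_neg_distrib]
  refine Finset.sum_congr rfl fun i _ => ?_
  rw [← Complex.ofReal_mul, Complex.ofReal_re, negMulLog]; ring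

lemma star_mul_mul_apply_self (ρ V U : Matrix n n ℂ) (l : n → ℝ)
    (h : ρ = U * diagonal (fun i => (l i : ℂ)) * star U) (j : n) :
    (star V * ρ * V) j j = ((∑ i, Complex.normSq ((star V * U) j i) * l i : ℝ) : ℂ) := by
  have e : star V * ρ * V = (star V * U) * diagonal (fun i => (l i : ℂ)) * star (star V * U) := by
    rw [h, star_mul, star_star]; simp only [Matrix.mul_assoc]
  rw [e, Matrix.mul_apply]
  push_cast
  refine Finset.sum_congr rfl fun i _ => ?_
  rw [mul_diagonal, Matrix.star_apply, Complex.normSq_eq_conj_mul_self, RCLike.star_def]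
  ring

lemma sum_normSq_row {W : Matrix n n ℂ} (h : W * star W = 1) (j : n) :
    ∑ i, Complex.normSq (W j i) = 1 := by
  have := congrFun (congrFun h j) j
  rw [Matrix.mul_apply, Matrix.one_apply_eq] at this
  have e : ((∑ i, Complex.normSq (W j i) : ℝ) : ℂ) = 1 := by
    rw [← this]
    push_cast
    refine Finset.sum_congr rfl fun i _ => ?_
    rw [Matrix.star_apply, Complex.normSq_eq_conj_mul_self, RCLike.star_def]; ring
  exact_mod_cast e

lemma sum_normSq_col {W : Matrix n n ℂ} (h : star W * W = 1) (i : n) :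
    ∑ j, Complex.normSq (W j i) = 1 := by
  have := sum_normSq_row (W := star W) (by rwa [star_star]) i
  simpa [Matrix.star_apply] using this

/-- Measuring in an orthonormal basis does not decrease the entropy. -/
lemma entropy_le_sum_negMulLog_diag {ρ V : Matrix n n ℂ} (hρ : ρ.PosSemidef)
    (hV : V ∈ unitary (Matrix n n ℂ)) :
    entropy ρ ≤ ∑ j, negMulLog ((star V * ρ * V) j j).re := by
  have hU := hρ.1.eigenvectorUnitary.2
  have hW : star V * (hρ.1.eigenvectorUnitary : Matrix n n ℂ) ∈ unitary (Matrix n n ℂ) :=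
    mul_mem (Unitary.star_mem hV) hU
  rw [entropy_eq_sum_negMulLog hρ.1]
  set W := star V * (hρ.1.eigenvectorUnitary : Matrix n n ℂ)
  -- The weights `|W j i|²` are doubly stochastic: column sums insert them, row sums permit Jensen.
  calc ∑ i, negMulLog (hρ.1.eigenvalues i)
      = ∑ i, (∑ j, Complex.normSq (W j i)) * negMulLog (hρ.1.eigenvalues i) := by
        simp [sum_normSq_col (Unitary.mem_iff.1 hW).1]
    _ = ∑ j, ∑ i, Complex.normSq (W j i) • negMulLog (hρ.1.eigenvalues i) := by
        simp only [Finset.sum_mul, smul_eq_mul]; exact Finset.sum_comm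
    _ ≤ ∑ j, negMulLog ((star V * ρ * V) j j).re := by
        refine Finset.sum_le_sum fun j _ => ?_
        rw [star_mul_mul_apply_self ρ V _ _ (eq_conj_diagonal hρ.1), Complex.ofReal_re]
        exact concaveOn_negMulLog.le_map_sum (fun i _ => Complex.normSq_nonneg _)
          (sum_normSq_row (Unitary.mem_iff.1 hW).2 j) fun i _ => hρ.eigenvalues_nonneg i

lemma entropy_eq_sum_negMulLog_diag {ρ : Matrix n n ℂ} (h : ρ.IsHermitian) :
    entropy ρ = ∑ j, negMulLog ((star (h.eigenvectorUnitary : Matrix n n ℂ) * ρ *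
      h.eigenvectorUnitary) j j).re := by
  rw [entropy_eq_sum_negMulLog h]
  refine Finset.sum_congr rfl fun j _ => ?_
  rw [star_mul_mul_apply_self ρ _ _ _ (eq_conj_diagonal h), Complex.ofReal_re,
    Unitary.coe_star_mul_self]
  simp [Matrix.one_apply, apply_ite Complex.normSq]

/-! ### Lipschitz continuity of the entropy in the amplitudes -/

lemma hsSq_unitary_mul {V : Matrix n n ℂ} (hV : V ∈ unitary (Matrix n n ℂ)) (X : Matrix n m ℂ) :
    hsSq (star V * X) = hsSq X := by
  rw [hsSq_eq_re_trace, hsSq_eq_re_trace, conjTranspose_mul, star_eq_conjTranspose,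
    conjTranspose_conjTranspose, Matrix.mul_assoc, Matrix.trace_mul_comm]
  simp only [Matrix.mul_assoc]
  rw [← star_eq_conjTranspose V, (Unitary.mem_iff.1 hV).2, Matrix.mul_one]

/-- Read both states in an eigenbasis of `X * Xᴴ`: this is exact for `X` and only raises the entropy
for `Y`, the right direction for a one-sided bound. Row norms are 1-Lipschitz, so the amplitude
estimate applies. -/
lemma entropy_sub_entropy_le (hd : 3 ≤ Fintype.card n) {X Y : Matrix n m ℂ}
    (hX : hsSq X = 1) (hY : hsSq Y = 1) :
    entropy (Y * Yᴴ) - entropy (X * Xᴴ) ≤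
      2 * √2 * log (Fintype.card n) * √(hsSq (Y - X)) := by
  have hXp := posSemidef_self_mul_conjTranspose X
  have hYp := posSemidef_self_mul_conjTranspose Y
  set V := hXp.1.eigenvectorUnitary
  have h1 := entropy_eq_sum_negMulLog_diag hXp.1
  have h2 := entropy_le_sum_negMulLog_diag hYp V.2
  simp only [diag_re_eq_rowNorm_sq] at h1 h2
  have h3 := sum_negMulLog_sq_sub_le hd
    (r := rowNorm (star (V : Matrix n n ℂ) * X)) (s := rowNorm (star (V : Matrix n n ℂ) * Y))
    (fun _ => norm_nonneg _) (fun _ => norm_nonneg _)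
    (by rw [sum_rowNorm_sq, hsSq_unitary_mul V.2, hX])
    (by rw [sum_rowNorm_sq, hsSq_unitary_mul V.2, hY])
  have h4 := sum_rowNorm_sub_sq_le (star (V : Matrix n n ℂ) * X) (star (V : Matrix n n ℂ) * Y)
  rw [← Matrix.mul_sub, hsSq_unitary_mul V.2] at h4
  have h5 : 0 ≤ 2 * √2 * log (Fintype.card n) := by
    have := Real.log_natCast_nonneg (Fintype.card n); positivity
  have h6 := mul_le_mul_of_nonneg_left (Real.sqrt_le_sqrt h4) h5
  linarith

lemma abs_entropy_sub_entropy_le (hd : 3 ≤ Fintype.card n) {X Y : Matrix n m ℂ}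
    (hX : hsSq X = 1) (hY : hsSq Y = 1) :
    |entropy (Y * Yᴴ) - entropy (X * Xᴴ)| ≤
      2 * √2 * log (Fintype.card n) * √(hsSq (Y - X)) := by
  have h := entropy_sub_entropy_le hd hY hX
  have e : hsSq (X - Y) = hsSq (Y - X) := by simp only [hsSq, Matrix.sub_apply, norm_sub_rev]
  rw [e] at h
  exact abs_sub_le_iff.2 ⟨entropy_sub_entropy_le hd hX hY, h⟩

end Entropy

/-! ### Measurement of an observable -/

section Measured

variable {n m : Type*} [Fintype n] [DecidableEq n]

lemma eigenProj_isHermitian (N : Matrix n n ℂ) (μ : ℂ) : (eigenProj N μ).IsHermitian := by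
  rw [← isSymmetric_toEuclideanLin_iff, eigenProj, LinearEquiv.apply_symm_apply]
  exact Submodule.starProjection_isSymmetric _

lemma eigenProj_mul_self (N : Matrix n n ℂ) (μ : ℂ) :
    eigenProj N μ * eigenProj N μ = eigenProj N μ := by
  apply (toEuclideanLin (𝕜 := ℂ) (m := n) (n := n)).injective
  ext x : 1
  rw [toLpLin_mul_same, LinearMap.comp_apply]
  simp only [eigenProj, LinearEquiv.apply_symm_apply]
  exact congrArg (fun f => f x) (Submodule.isIdempotentElem_starProjection
    (Module.End.eigenspace (toEuclideanLin N) μ)).eq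

lemma sum_eigenProj {N : Matrix n n ℂ} (hN : N.IsHermitian) :
    ∑ μ : Module.End.Eigenvalues (toEuclideanLin (𝕜 := ℂ) N), eigenProj N (μ : ℂ) = 1 := by
  have hT := isSymmetric_toEuclideanLin_iff.2 hN
  apply (toEuclideanLin (𝕜 := ℂ) (m := n) (n := n)).injective
  ext x : 1
  simp only [map_sum, eigenProj, LinearEquiv.apply_symm_apply, LinearMap.sum_apply]
  have hx : x ∈ ⨆ μ : Module.End.Eigenvalues (toEuclideanLin (𝕜 := ℂ) N),
      Module.End.eigenspace (toEuclideanLin N) (μ : ℂ) := by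
    have := (Submodule.orthogonal_eq_bot_iff).1 hT.orthogonalComplement_iSup_eigenspaces_eq_bot'
    rw [this]; trivial
  have := hT.orthogonalFamily_eigenspaces'.sum_projection_of_mem_iSup x hx
  simpa using this

/-- The amplitudes of the measured state: `X ↦ ∑ μ, Π_μ X ⊗ |μ⟩`. -/
noncomputable def measuredAmplitude (N : Matrix n n ℂ) (X : Matrix n m ℂ) :
    Matrix n (Module.End.Eigenvalues (toEuclideanLin (𝕜 := ℂ) N) × m) ℂ :=
  Matrix.of fun i p => (eigenProj N (p.1 : ℂ) * X) i p.2

lemma measuredAmplitude_sub (N : Matrix n n ℂ) (X Y : Matrix n m ℂ) :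
    measuredAmplitude N (Y - X) = measuredAmplitude N Y - measuredAmplitude N X := by
  ext i p
  simp [measuredAmplitude, Matrix.mul_sub]

variable [Fintype m]

lemma measured_mul_conjTranspose (N : Matrix n n ℂ) (X : Matrix n m ℂ) :
    measured N (X * Xᴴ) = measuredAmplitude N X * (measuredAmplitude N X)ᴴ := by
  have e : measured N (X * Xᴴ) = ∑ μ : Module.End.Eigenvalues (toEuclideanLin (𝕜 := ℂ) N),
      (eigenProj N (μ : ℂ) * X) * (eigenProj N (μ : ℂ) * X)ᴴ := by
    refine Finset.sum_congr rfl fun μ _ => ?_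
    rw [conjTranspose_mul, (eigenProj_isHermitian N μ).eq]
    simp only [Matrix.mul_assoc]
  rw [e]
  ext i j
  rw [Matrix.sum_apply, Matrix.mul_apply, Fintype.sum_prod_type]
  rfl

/-- The `Π_μ` are idempotent and sum to the identity, so measuring preserves the trace. -/
lemma hsSq_measuredAmplitude {N : Matrix n n ℂ} (hN : N.IsHermitian) (X : Matrix n m ℂ) :
    hsSq (measuredAmplitude N X) = hsSq X := by
  rw [hsSq_eq_re_trace, ← measured_mul_conjTranspose, measured, trace_sum, hsSq_eq_re_trace]
  have e : ∀ μ : Module.End.Eigenvalues (toEuclideanLin (𝕜 := ℂ) N),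
      (eigenProj N (μ : ℂ) * (X * Xᴴ) * eigenProj N (μ : ℂ)).trace =
        (eigenProj N (μ : ℂ) * (X * Xᴴ)).trace := fun μ => by
    rw [Matrix.trace_mul_comm, ← Matrix.mul_assoc, eigenProj_mul_self]
  rw [Finset.sum_congr rfl fun μ _ => e μ, ← trace_sum, ← Finset.sum_mul, sum_eigenProj hN,
    Matrix.one_mul]

lemma abs_measured_entropy_gap_sub_le (hd : 3 ≤ Fintype.card n) {N : Matrix n n ℂ}
    (hN : N.IsHermitian) {X Y : Matrix n m ℂ} (hX : hsSq X = 1) (hY : hsSq Y = 1) :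
    |(entropy (measured N (Y * Yᴴ)) - entropy (Y * Yᴴ)) -
        (entropy (measured N (X * Xᴴ)) - entropy (X * Xᴴ))| ≤
      4 * √2 * log (Fintype.card n) * √(hsSq (Y - X)) := by
  have h1 := abs_entropy_sub_entropy_le hd hX hY
  have h2 := abs_entropy_sub_entropy_le hd (X := measuredAmplitude N X)
    (Y := measuredAmplitude N Y) (by rw [hsSq_measuredAmplitude hN, hX])
    (by rw [hsSq_measuredAmplitude hN, hY])
  rw [← measuredAmplitude_sub, hsSq_measuredAmplitude hN, ← measured_mul_conjTranspose,
    ← measured_mul_conjTranspose] at h2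
  rw [abs_le] at h1 h2 ⊢
  constructor <;> linarith

end Measured

/-! ### Purifications attaining the Bures distance -/

section Bures

variable {n : Type*} [Fintype n] [DecidableEq n]

lemma inner_toEuclideanLin_toEuclideanLin (A B : Matrix n n ℂ) (x y : EuclideanSpace ℂ n) :
    inner ℂ (toEuclideanLin A x) (toEuclideanLin B y) = inner ℂ x (toEuclideanLin (Aᴴ * B) y) := by
  rw [toLpLin_mul_same, LinearMap.comp_apply, toEuclideanLin_conjTranspose_eq_adjoint,
    LinearMap.adjoint_inner_right]

/-- Two square matrices with the same absolute value differ by a unitary factor. -/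
lemma exists_unitary_mul_eq {A B : Matrix n n ℂ} (h : Aᴴ * A = Bᴴ * B) :
    ∃ V ∈ unitary (Matrix n n ℂ), V * A = B := by
  set f := toEuclideanLin (𝕜 := ℂ) A
  set g := toEuclideanLin (𝕜 := ℂ) B
  have hfg : ∀ x, ‖g x‖ = ‖f x‖ := fun x => by
    have : inner ℂ (g x) (g x) = inner ℂ (f x) (f x) := by
      rw [inner_toEuclideanLin_toEuclideanLin, inner_toEuclideanLin_toEuclideanLin, h]
    rw [@norm_eq_sqrt_re_inner ℂ, @norm_eq_sqrt_re_inner ℂ, this]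
  have hker : LinearMap.ker f ≤ LinearMap.ker g := fun x hx => by
    rw [LinearMap.mem_ker, ← norm_eq_zero, hfg, LinearMap.mem_ker.1 hx, norm_zero]
  -- The assignment `f x ↦ g x` is well defined and isometric on the range of `f`; in finite
  -- dimension it extends to an isometry of the whole space.
  let L₀ : LinearMap.range f →ₗ[ℂ] EuclideanSpace ℂ n :=
    ((LinearMap.ker f).liftQ g hker).comp f.quotKerEquivRange.symm.toLinearMap
  have hL₀ : ∀ x, L₀ ⟨f x, LinearMap.mem_range_self f x⟩ = g x := fun x => by
    have : f.quotKerEquivRange.symm ⟨f x, LinearMap.mem_range_self f x⟩ =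
        (LinearMap.ker f).mkQ x := f.quotKerEquivRange_symm_apply_image x _
    simp only [L₀, LinearMap.comp_apply, LinearEquiv.coe_coe, this]
    exact Submodule.liftQ_apply _ _ _
  let L : LinearMap.range f →ₗᵢ[ℂ] EuclideanSpace ℂ n :=
    ⟨L₀, by rintro ⟨_, x, rfl⟩; rw [hL₀, hfg]; rfl⟩
  have hLf : ∀ x, L.extend (f x) = g x := fun x =>
    (L.extend_apply ⟨f x, LinearMap.mem_range_self f x⟩).trans (hL₀ x)
  set V := (toEuclideanLin (𝕜 := ℂ) (m := n) (n := n)).symm L.extend.toLinearMap with hV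
  have hVlin : toEuclideanLin V = L.extend.toLinearMap := LinearEquiv.apply_symm_apply _ _
  have hVV : star V * V = 1 := by
    apply (toEuclideanLin (𝕜 := ℂ) (m := n) (n := n)).injective
    ext x : 1
    refine ext_inner_left ℂ fun y => ?_
    rw [star_eq_conjTranspose, ← inner_toEuclideanLin_toEuclideanLin, hVlin]
    simp
  refine ⟨V, Unitary.mem_iff.2 ⟨hVV, mul_eq_one_comm.1 hVV⟩, ?_⟩
  apply (toEuclideanLin (𝕜 := ℂ) (m := n) (n := n)).injective
  ext x : 1
  rw [toLpLin_mul_same, LinearMap.comp_apply, hVlin]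
  exact hLf x

lemma cfc_sqrt_isHermitian (ρ : Matrix n n ℂ) : (cfc Real.sqrt ρ).IsHermitian :=
  cfc_predicate (R := ℝ) (p := IsSelfAdjoint) Real.sqrt ρ

lemma cfc_sqrt_mul_self {ρ : Matrix n n ℂ} (h : ρ.PosSemidef) :
    cfc Real.sqrt ρ * cfc Real.sqrt ρ = ρ := by
  have hU : star (h.1.eigenvectorUnitary : Matrix n n ℂ) * h.1.eigenvectorUnitary = 1 :=
    Unitary.coe_star_mul_self _
  have h1 := eq_conj_diagonal h.1
  rw [cfc_eq_conj_diagonal h.1 Real.sqrt]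
  conv_rhs => rw [h1]
  simp only [Matrix.mul_assoc]
  rw [← Matrix.mul_assoc (star _) (h.1.eigenvectorUnitary : Matrix n n ℂ), hU, Matrix.one_mul,
    ← Matrix.mul_assoc (diagonal _) (diagonal _), diagonal_mul_diagonal]
  congr 3
  ext i
  rw [← Complex.ofReal_mul, Real.mul_self_sqrt (h.eigenvalues_nonneg i)]

lemma trace_cfc_sqrt_re_nonneg {ρ : Matrix n n ℂ} (h : ρ.PosSemidef) :
    0 ≤ (cfc Real.sqrt ρ).trace.re := by
  rw [cfc_eq_conj_diagonal h.1 Real.sqrt, Matrix.trace_mul_comm, ← Matrix.mul_assoc,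
    Unitary.coe_star_mul_self, Matrix.one_mul, trace_diagonal, Complex.re_sum]
  exact Finset.sum_nonneg fun i _ => by rw [Complex.ofReal_re]; exact Real.sqrt_nonneg _

/-- The attainment half of Uhlmann's theorem. With `R = √ρ`, `S = √σ`, a polar decomposition gives a
unitary `V` with `V R S = √(S ρ S)`; then `X = R V⋆` and `Y = S` have overlap `Tr (S V R) = √F`. -/
lemma exists_hsSq_sub_eq_buresDist {ρ σ : Matrix n n ℂ} (hρ : IsDensity ρ) (hσ : IsDensity σ) :
    ∃ X Y : Matrix n n ℂ, X * Xᴴ = ρ ∧ Y * Yᴴ = σ ∧ √(hsSq (Y - X)) = buresDist σ ρ := by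
  set R := cfc Real.sqrt ρ with hR
  set S := cfc Real.sqrt σ with hS
  have hRH : Rᴴ = R := cfc_sqrt_isHermitian ρ
  have hSH : Sᴴ = S := cfc_sqrt_isHermitian σ
  have hRR : R * R = ρ := cfc_sqrt_mul_self hρ.1
  have hSS : S * S = σ := cfc_sqrt_mul_self hσ.1
  have hK : (S * R) * (S * R)ᴴ = S * ρ * S := by
    rw [conjTranspose_mul, hRH, hSH, ← hRR]; simp only [Matrix.mul_assoc]
  have hP : (S * ρ * S).PosSemidef := hK ▸ posSemidef_self_mul_conjTranspose _
  set P := cfc Real.sqrt (S * ρ * S) with hPdef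
  have hPH : Pᴴ = P := cfc_sqrt_isHermitian _
  have hPP : P * P = S * ρ * S := cfc_sqrt_mul_self hP
  obtain ⟨V, hV, hVP⟩ := exists_unitary_mul_eq (A := (S * R)ᴴ) (B := P) (by
    rw [conjTranspose_conjTranspose, hK, hPH, hPP])
  have hVV := (Unitary.mem_iff.1 hV).1
  have hX : (R * star V) * (R * star V)ᴴ = ρ := by
    rw [conjTranspose_mul, star_eq_conjTranspose, conjTranspose_conjTranspose, hRH, Matrix.mul_assoc,
      ← Matrix.mul_assoc Vᴴ, ← star_eq_conjTranspose, hVV, Matrix.one_mul, hRR]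
  have hY : S * Sᴴ = σ := by rw [hSH, hSS]
  refine ⟨R * star V, S, hX, hY, ?_⟩
  have hYX : S * (R * star V)ᴴ = S * (V * R) := by
    rw [conjTranspose_mul, star_eq_conjTranspose, conjTranspose_conjTranspose, hRH]
  have ht : (S * (V * R)).trace = P.trace := by
    rw [← hVP, conjTranspose_mul, hRH, hSH, Matrix.trace_mul_comm, Matrix.mul_assoc]
  rw [hsSq_sub, hYX, ht, hsSq_eq_re_trace, hsSq_eq_re_trace, hX, hY, hρ.2, hσ.2, buresDist,
    fidelity, Real.sqrt_sq (trace_cfc_sqrt_re_nonneg hP), ← hPdef]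
  congr 1
  norm_num; ring

end Bures

end NumberEntanglement

/-! ### Number entanglement: specialisation to `N_A ⊗ 1_B` -/

namespace NumberEntanglement

open Matrix in
lemma abs_numberEntanglement_sub_le {A B C : Type*}
    [Fintype A] [DecidableEq A] [Fintype B] [DecidableEq B] [Fintype C]
    (hd : 3 ≤ Fintype.card A * Fintype.card B) {NA : Matrix A A ℂ} (hNA : NA.IsHermitian)
    {ρ σ : Matrix (A × B) (A × B) ℂ} (hρ : ρ.trace = 1) (hσ : σ.trace = 1)
    {X Y : Matrix (A × B) C ℂ} (hX : X * Xᴴ = ρ) (hY : Y * Yᴴ = σ) :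
    |numberEntanglement NA σ - numberEntanglement NA ρ| ≤
      4 * √2 * Real.log ((Fintype.card A : ℝ) * (Fintype.card B : ℝ)) * √(hsSq (Y - X)) := by
  have hN : (NA ⊗ₖ (1 : Matrix B B ℂ)).IsHermitian := by
    rw [IsHermitian, conjTranspose_kronecker, hNA.eq, conjTranspose_one]
  have h := abs_measured_entropy_gap_sub_le (by rwa [Fintype.card_prod]) hN (X := X) (Y := Y)
    (by rw [hsSq_eq_re_trace, hX, hρ, Complex.one_re])
    (by rw [hsSq_eq_re_trace, hY, hσ, Complex.one_re])
  rw [hX, hY, Fintype.card_prod, Nat.cast_mul] at h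
  exact h

end NumberEntanglement

theorem propositionT {A : Type u} {B : Type v}
    [Fintype A] [DecidableEq A] [Fintype B] [DecidableEq B]
    (hd : 3 ≤ Fintype.card A * Fintype.card B)
    (NA : Matrix A A ℂ) (hNA : NA.IsHermitian)
    (ρ σ : Matrix (A × B) (A × B) ℂ) (hρ : IsDensity ρ) (hσ : IsDensity σ) :
    (∀ (C : Type w) [Fintype C] (φ ψ : EuclideanSpace ℂ ((A × B) × C)),
      IsPurification φ ρ → IsPurification ψ σ →
        |numberEntanglement NA σ - numberEntanglement NA ρ| ≤
            4 * √2 * Real.log ((Fintype.card A : ℝ) * (Fintype.card B : ℝ)) * ‖ψ - φ‖ ∧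
        ∀ D : ℕ, Fintype.card A * Fintype.card B ≤ D →
          |numberEntanglement NA σ - numberEntanglement NA ρ| ≤
            4 * √2 * Real.log (D : ℝ) * ‖ψ - φ‖) ∧
    |numberEntanglement NA σ - numberEntanglement NA ρ| ≤
      4 * √2 * Real.log ((Fintype.card A : ℝ) * (Fintype.card B : ℝ)) * buresDist σ ρ := by
  constructor
  · intro C _ φ ψ hφ hψ
    -- With the vectors reshaped into matrices, the purification condition is `X * Xᴴ = ρ` by
    -- unfolding.
    have h := abs_numberEntanglement_sub_le hd hNA hρ.2 hσ.2
      (X := Matrix.of fun i k => φ (i, k)) (Y := Matrix.of fun i k => ψ (i, k)) hφ hψ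
    have e : √(hsSq ((Matrix.of fun i k => ψ (i, k)) - Matrix.of fun i k => φ (i, k))) =
        ‖ψ - φ‖ := by
      rw [EuclideanSpace.norm_eq, Fintype.sum_prod_type]
      rfl
    rw [e] at h
    refine ⟨h, fun D hD => h.trans ?_⟩
    have hpos : (0 : ℝ) < (Fintype.card A : ℝ) * (Fintype.card B : ℝ) := by
      exact_mod_cast (by omega : 0 < Fintype.card A * Fintype.card B)
    have hle : (Fintype.card A : ℝ) * (Fintype.card B : ℝ) ≤ D := by exact_mod_cast hD
    gcongr
  · obtain ⟨X, Y, hX, hY, he⟩ := exists_hsSq_sub_eq_buresDist hρ hσ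
    rw [← he]
    exact abs_numberEntanglement_sub_le hd hNA hρ.2 hσ.2 hX hY
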